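/- Let $X$ be a finite quasi-metric space, i.e. a finite set with a function $d\colon X\times X\to[0,\infty)$ satisfying $d(x,z)\le d(x,y)+d(y,z)$ and $d(x,y)=0\iff x=y$ (symmetry is not required). For $k\ge 0$ and $\ell\ge 0$ let $\mathrm{MC}_{k,\ell}(X)$ be the free abelian group on the tuples $(x_0,\dots,x_k)\in X^{k+1}$ with $x_0\ne x_1\ne\cdots\ne x_k$ (consecutive entries distinct) and $d(x_0,x_1)+\cdots+d(x_{k-1},x_k)=\ell$. It becomes a chain complex with differential $\partial=\sum_{i=1}^{k-1}(-1)^i\partial_i\colon \mathrm{MC}_{k,\ell}(X)\to\mathrm{MC}_{k-1,\ell}(X)$, where $\partial_i(x_0,\dots,x_k)=(x_0,\dots,\widehat{x_i},\dots,x_k)$ if $d(x_{i-1},x_{i+1})=d(x_{i-1},x_i)+d(x_i,x_{i+1})$ and $\partial_i(x_0,\dots,x_k)=0$ otherwise. The magnitude cohomology groups are $\mathrm{MH}^k_\ell(X)=H^k(\mathrm{Hom}(\mathrm{MC}_{*,\ell}(X),\mathbb Z))$. Let $\mathbb Q(\!(q^{\mathbb R})\!)$ be the field of Hahn series in $q$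 with rational coefficients and real exponents, with its valuation topology: the sets $\{g : \text{every exponent occurring in } g-f \text{ is greater than } r\}$, $r\in\mathbb R$, form a neighbourhood basis at $f$. Then the matrix $Z_X=(q^{d(x,y)})_{x,y\in X}$ is invertible over $\mathbb Q(\!(q^{\mathbb R})\!)$, so that the magnitude $\#X=\sum_{x,y\in X}(Z_X^{-1})(x,y)$ is defined; each group $\mathrm{MH}^k_\ell(X)$ is finitely generated; and $$\#X=\sum_{\ell\ge 0}\ \sum_{k=0}^\infty(-1)^k\,\mathrm{rank}\bigl(\mathrm{MH}^k_\ell(X)\bigr)\,q^\ell,$$ where for each $\ell$ only finitely many terms of the sum over $k$ are nonzero, and the infinite sum over real $\ell\ge 0$ converges unconditionally in the topology of $\mathbb Q(\!(q^{\mathbb R})\!)$. -/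

import Mathlib

open scoped NNReal

/-- A quasi-metric space: the axioms of a metric space with the symmetry of the distance dropped.
All distances are finite, and distinct points have nonzero distance in each direction. -/
class QuasiMetricSpace (X : Type*) where
  /-- The distance from the first point to the second. -/
  qdist : X → X → ℝ
  qdist_nonneg : ∀ x y, 0 ≤ qdist x y
  qdist_self : ∀ x, qdist x x = 0
  eq_of_qdist_eq_zero : ∀ x y, qdist x y = 0 → x = y
  qdist_triangle : ∀ x y z, qdist x z ≤ qdist x y + qdist y z

namespace QuasiMetricSpace

noncomputable section

/-! ### The field of Hahn series and its topology -/

/-- The field `ℚ((q^ℝ))` of Hahn series with rational coefficients and real exponents;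
the monomial `q ^ ℓ` is `HahnSeries.single ℓ 1`. -/
abbrev HahnField : Type := HahnSeries ℝ ℚ

/-- The valuation topology on the field of Hahn series: the balls around `f` are the sets of all
`g` such that the lowest exponent occurring in `g - f` is greater than a given `r`
(`orderTop 0 = ⊤`). -/
instance hahnTopology : TopologicalSpace HahnField where
  IsOpen U := ∀ f ∈ U, ∃ r : ℝ, ∀ g : HahnField, (r : WithTop ℝ) < (g - f).orderTop → g ∈ U
  isOpen_univ := fun _ _ => ⟨0, fun _ _ => trivial⟩
  isOpen_inter := by
    rintro U V hU hV f ⟨hfU, hfV⟩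
    obtain ⟨r, hr⟩ := hU f hfU
    obtain ⟨s, hs⟩ := hV f hfV
    refine ⟨max r s, fun g hg => ⟨hr g (lt_of_le_of_lt ?_ hg), hs g (lt_of_le_of_lt ?_ hg)⟩⟩
    · exact WithTop.coe_le_coe.2 (le_max_left r s)
    · exact WithTop.coe_le_coe.2 (le_max_right r s)
  isOpen_sUnion := by
    rintro S hS f ⟨U, hUS, hfU⟩
    obtain ⟨r, hr⟩ := hS U hUS f hfU
    exact ⟨r, fun g hg => ⟨U, hUS, hr g hg⟩⟩

/-! ### Magnitude -/

/-- The matrix with entries `q ^ d(x, y)`. -/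
def zetaMatrix (X : Type*) [QuasiMetricSpace X] : Matrix X X HahnField :=
  Matrix.of fun x y => HahnSeries.single (qdist x y) (1 : ℚ)

/-- The magnitude of a finite quasi-metric space: the sum of all entries of the inverse of its zeta
matrix. It is meaningful when the zeta matrix is invertible. -/
def magnitude (X : Type*) [Fintype X] [DecidableEq X] [QuasiMetricSpace X] : HahnField :=
  ∑ x, ∑ y, (zetaMatrix X)⁻¹ x y

/-! ### The magnitude chain complex -/

section

variable {X : Type*}

/-- For `i : Fin k`, omit the inner vertex `x (i + 1)` of the tuple `(x₀, …, xₖ₊₁)`. -/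
def omitInner {k : ℕ} (x : Fin (k + 2) → X) (i : Fin k) : Fin (k + 1) → X :=
  fun j => x (i.castSucc.succ.succAbove j)

lemma omitInner_castSucc_of_lt {k : ℕ} (x : Fin (k + 2) → X) {i j : Fin k} (h : j < i) :
    omitInner x i j.castSucc = x (i.succ.succAbove j).castSucc ∧
      omitInner x i j.succ = x (i.succ.succAbove j).succ := by
  unfold omitInner
  constructor <;> congr 1 <;> ext <;>
    simp only [Fin.succAbove, Fin.lt_def, Fin.val_castSucc, Fin.val_succ] at h ⊢ <;>
    split_ifs <;> simp <;> omega

lemma omitInner_castSucc_of_gt {k : ℕ} (x : Fin (k + 2) → X) {i j : Fin k} (h : i < j) :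
    omitInner x i j.castSucc = x (i.succ.succAbove j).castSucc ∧
      omitInner x i j.succ = x (i.succ.succAbove j).succ := by
  unfold omitInner
  constructor <;> congr 1 <;> ext <;>
    simp only [Fin.succAbove, Fin.lt_def, Fin.val_castSucc, Fin.val_succ] at h ⊢ <;>
    split_ifs <;> simp <;> omega

lemma omitInner_self {k : ℕ} (x : Fin (k + 2) → X) (i : Fin k) :
    omitInner x i i.castSucc = x i.castSucc.castSucc ∧
      omitInner x i i.succ = x i.succ.succ := by
  unfold omitInner
  constructor <;> congr 1 <;> ext <;> simp [Fin.succAbove, Fin.lt_def]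

lemma omitInner_comm {k : ℕ} (x : Fin (k + 3) → X) (i : Fin k) (j : Fin (k + 1))
    (h : i.castSucc < j) :
    omitInner (omitInner x j) i =
      omitInner (omitInner x i.castSucc) (j.pred (Fin.ne_zero_of_lt h)) := by
  funext m
  unfold omitInner
  congr 1
  ext
  simp only [Fin.succAbove, Fin.lt_def, Fin.val_castSucc, Fin.val_succ, Fin.val_pred] at h ⊢
  split_ifs <;> simp_all <;> omega

end

section

variable {X : Type*} [QuasiMetricSpace X]

/-- The length `d(x₀, x₁) + ⋯ + d(xₖ₋₁, xₖ)` of a tuple. -/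
def length {k : ℕ} (x : Fin (k + 1) → X) : ℝ :=
  ∑ i : Fin k, qdist (x i.castSucc) (x i.succ)

/-- Simplices of degree `k` and length `ℓ`: tuples `(x₀, …, xₖ)` with distinct consecutive
entries. -/
def IsSimplex (k : ℕ) (ℓ : ℝ) (x : Fin (k + 1) → X) : Prop :=
  (∀ i : Fin k, x i.castSucc ≠ x i.succ) ∧ length x = ℓ

/-- The condition `d(xᵢ, xᵢ₊₂) = d(xᵢ, xᵢ₊₁) + d(xᵢ₊₁, xᵢ₊₂)` under which the inner vertex
`xᵢ₊₁` may be omitted. -/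
def IsBetween {k : ℕ} (x : Fin (k + 2) → X) (i : Fin k) : Prop :=
  qdist (x i.castSucc.castSucc) (x i.succ.succ) =
    qdist (x i.castSucc.castSucc) (x i.castSucc.succ) + qdist (x i.castSucc.succ) (x i.succ.succ)

lemma length_omitInner {k : ℕ} (x : Fin (k + 2) → X) (i : Fin k) :
    length (omitInner x i) = length x + (qdist (x i.castSucc.castSucc) (x i.succ.succ) -
      (qdist (x i.castSucc.castSucc) (x i.castSucc.succ) +
        qdist (x i.castSucc.succ) (x i.succ.succ))) := by
  have key : length (omitInner x i) - ∑ j : Fin k, qdist (x (i.succ.succAbove j).castSucc)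
      (x (i.succ.succAbove j).succ) = qdist (x i.castSucc.castSucc) (x i.succ.succ) -
        qdist (x i.castSucc.castSucc) (x i.castSucc.succ) := by
    unfold length
    rw [← Finset.sum_sub_distrib, Fintype.sum_eq_single i]
    · rw [(omitInner_self x i).1, (omitInner_self x i).2]
      have : i.succ.succAbove i = i.castSucc := by
        ext; simp [Fin.succAbove, Fin.lt_def]
      rw [this]
    · intro j hj
      rcases lt_or_gt_of_ne hj with h | h
      · rw [(omitInner_castSucc_of_lt x h).1, (omitInner_castSucc_of_lt x h).2, sub_self]
      · rw [(omitInner_castSucc_of_gt x h).1, (omitInner_castSucc_of_gt x h).2, sub_self]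
  have h2 : length x = qdist (x i.succ.castSucc) (x i.succ.succ) +
      ∑ j : Fin k, qdist (x (i.succ.succAbove j).castSucc) (x (i.succ.succAbove j).succ) := by
    unfold length
    rw [Fin.sum_univ_succAbove _ i.succ]
  have h3 : i.succ.castSucc = i.castSucc.succ := rfl
  rw [h3] at h2
  linarith

lemma isBetween_iff {k : ℕ} (x : Fin (k + 2) → X) (i : Fin k) :
    IsBetween x i ↔ length (omitInner x i) = length x := by
  rw [length_omitInner, IsBetween]
  constructor <;> intro h <;> linarith

lemma length_omitInner_le {k : ℕ} (x : Fin (k + 2) → X) (i : Fin k) :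
    length (omitInner x i) ≤ length x := by
  rw [length_omitInner]
  linarith [qdist_triangle (x i.castSucc.castSucc) (x i.castSucc.succ) (x i.succ.succ)]

/-- An inner face that satisfies the betweenness condition is a simplex of the same length. -/
lemma IsSimplex.omitInner {k : ℕ} {ℓ : ℝ} {x : Fin (k + 2) → X} (hx : IsSimplex (k + 1) ℓ x)
    {i : Fin k} (hi : IsBetween x i) : IsSimplex k ℓ (omitInner x i) := by
  refine ⟨fun j => ?_, ((isBetween_iff x i).1 hi).trans hx.2⟩
  rcases lt_trichotomy j i with h | rfl | h
  · rw [(omitInner_castSucc_of_lt x h).1, (omitInner_castSucc_of_lt x h).2]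
    exact hx.1 _
  · rw [(omitInner_self x j).1, (omitInner_self x j).2]
    intro h
    rw [IsBetween, ← h, qdist_self] at hi
    refine hx.1 j.castSucc (eq_of_qdist_eq_zero _ _ (le_antisymm ?_ (qdist_nonneg _ _)))
    linarith [qdist_nonneg (x j.castSucc.succ) (x j.castSucc.castSucc)]
  · rw [(omitInner_castSucc_of_gt x h).1, (omitInner_castSucc_of_gt x h).2]
    exact hx.1 _

end

/-- The magnitude chains of degree `k` and length `ℓ`: the free abelian group on the simplices of
degree `k` and length `ℓ`. -/
abbrev MC (X : Type*) [QuasiMetricSpace X] (k : ℕ) (ℓ : ℝ) : Type _ :=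
  {x : Fin (k + 1) → X // IsSimplex k ℓ x} →₀ ℤ

open Classical in
/-- The value on a simplex of the map that omits the inner vertex number `i + 1`: the resulting
simplex if the betweenness condition holds, and zero otherwise. -/
def faceSimplex {X : Type*} [QuasiMetricSpace X] {k : ℕ} {ℓ : ℝ} (i : Fin k)
    (x : {x : Fin (k + 2) → X // IsSimplex (k + 1) ℓ x}) : MC X k ℓ :=
  if h : IsBetween x.1 i then Finsupp.single ⟨omitInner x.1 i, x.2.omitInner h⟩ 1 else 0

/-- The `ℤ`-linear extension of `faceSimplex`. -/
def face (X : Type*) [QuasiMetricSpace X] {k : ℕ} (ℓ : ℝ) (i : Fin k) :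
    MC X (k + 1) ℓ →ₗ[ℤ] MC X k ℓ :=
  Finsupp.linearCombination ℤ (faceSimplex i)

/-- The differential `-∂₁ + ∂₂ - ⋯ + (-1) ^ k ∂ₖ` from chains of degree `k + 1` to chains of
degree `k`. -/
def boundary (X : Type*) [QuasiMetricSpace X] (k : ℕ) (ℓ : ℝ) :
    MC X (k + 1) ℓ →ₗ[ℤ] MC X k ℓ :=
  ∑ i : Fin k, (-1 : ℤ) ^ ((i : ℕ) + 1) • face X ℓ i

section

variable {X : Type*} [QuasiMetricSpace X]

open Classical in
lemma face_faceSimplex {k : ℕ} {ℓ : ℝ} (i : Fin k) (j : Fin (k + 1))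
    (x : {x : Fin (k + 3) → X // IsSimplex (k + 2) ℓ x}) :
    face X ℓ i (faceSimplex j x) =
      if h : IsSimplex k ℓ (omitInner (omitInner x.1 j) i) then
        Finsupp.single ⟨omitInner (omitInner x.1 j) i, h⟩ 1 else 0 := by
  have h1 := length_omitInner_le x.1 j
  have h2 := length_omitInner_le (omitInner x.1 j) i
  have hx := x.2.2
  by_cases hj : IsBetween x.1 j
  · rw [faceSimplex, dif_pos hj, face, Finsupp.linearCombination_single, one_smul, faceSimplex]
    by_cases hi : IsBetween (omitInner x.1 j) i
    · rw [dif_pos hi, dif_pos ((x.2.omitInner hj).omitInner hi)]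
    · rw [dif_neg hi, dif_neg]
      intro h
      rw [isBetween_iff] at hi hj
      exact hi (by rw [h.2, hj, hx])
  · rw [faceSimplex, dif_neg hj, map_zero, dif_neg]
    intro h
    rw [isBetween_iff] at hj
    have := h.2
    exact hj (by linarith)

open Classical in
lemma face_comp_face {k : ℕ} {ℓ : ℝ} (i : Fin k) (j : Fin (k + 1)) (h : i.castSucc < j) :
    face X ℓ i ∘ₗ face X ℓ j =
      face X ℓ (j.pred (Fin.ne_zero_of_lt h)) ∘ₗ face X ℓ i.castSucc := by
  refine Finsupp.lhom_ext' fun x => LinearMap.ext_ring ?_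
  simp only [LinearMap.comp_apply, Finsupp.lsingle_apply]
  have e : ∀ j' : Fin (k + 1), face X ℓ j' (Finsupp.single x 1) = faceSimplex j' x := fun j' => by
    rw [face, Finsupp.linearCombination_single, one_smul]
  rw [e, e, face_faceSimplex, face_faceSimplex]
  have e2 : ∀ y z : Fin (k + 1) → X, y = z →
      (if h : IsSimplex k ℓ y then Finsupp.single ⟨y, h⟩ (1 : ℤ) else 0 : MC X k ℓ) =
        if h : IsSimplex k ℓ z then Finsupp.single ⟨z, h⟩ (1 : ℤ) else 0 := by
    rintro y _ rfl
    rfl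
  exact e2 _ _ (omitInner_comm x.1 i j h)

/-- The magnitude chains form a chain complex. -/
theorem boundary_comp_boundary (k : ℕ) (ℓ : ℝ) :
    boundary X k ℓ ∘ₗ boundary X (k + 1) ℓ = 0 := by
  have hexp : boundary X k ℓ ∘ₗ boundary X (k + 1) ℓ = ∑ p : Fin k × Fin (k + 1),
      (-1 : ℤ) ^ ((p.1 : ℕ) + p.2) • (face X ℓ p.1 ∘ₗ face X ℓ p.2) := by
    rw [Fintype.sum_prod_type]
    refine LinearMap.ext fun c => ?_
    simp only [boundary, LinearMap.comp_apply, LinearMap.sum_apply, LinearMap.smul_apply, map_sum,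
      map_smul, Finset.smul_sum, smul_smul]
    rw [Finset.sum_comm]
    refine Finset.sum_congr rfl fun i _ => Finset.sum_congr rfl fun j _ => ?_
    congr 1
    ring
  rw [hexp]
  refine Finset.sum_involution
    (fun p _ => if h : p.1.castSucc < p.2 then (p.2.pred (Fin.ne_zero_of_lt h), p.1.castSucc)
      else (p.2.castPred (Fin.ne_last_of_lt
        (lt_of_le_of_lt (not_lt.1 h) (Fin.castSucc_lt_succ (i := p.1)))), p.1.succ)) ?_ ?_ ?_ ?_
  · rintro ⟨i, j⟩ -
    by_cases h : i.castSucc < j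
    · simp only [dif_pos h]
      rw [face_comp_face i j h, ← add_smul]
      have hj : (j : ℕ) = (j.pred (Fin.ne_zero_of_lt h) : ℕ) + 1 := by
        have := Fin.lt_def.1 h
        simp only [Fin.val_castSucc, Fin.val_pred] at this ⊢
        omega
      rw [hj, Fin.val_castSucc, ← add_assoc, pow_succ, add_comm (i : ℕ)]
      simp
    · simp only [dif_neg h]
      have hlt : j < i.succ := lt_of_le_of_lt (not_lt.1 h) (Fin.castSucc_lt_succ (i := i))
      have h' : (j.castPred (Fin.ne_last_of_lt hlt)).castSucc < i.succ := by simpa using hlt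
      rw [face_comp_face _ i.succ h']
      simp only [Fin.pred_succ, Fin.castSucc_castPred]
      rw [← add_smul, Fin.val_succ, Fin.coe_castPred, ← add_assoc, pow_succ, add_comm (i : ℕ)]
      simp
  · rintro ⟨i, j⟩ - - heq
    by_cases h : i.castSucc < j
    · simp only [dif_pos h, Prod.mk.injEq] at heq
      exact absurd heq.2 h.ne
    · simp only [dif_neg h, Prod.mk.injEq] at heq
      apply h
      rw [← heq.2]
      exact Fin.castSucc_lt_succ
  · intro _ _
    exact Finset.mem_univ _
  · rintro ⟨i, j⟩ -
    by_cases h : i.castSucc < j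
    · have h' : ¬ (j.pred (Fin.ne_zero_of_lt h)).castSucc < i.castSucc := by
        have := Fin.lt_def.1 h
        simp only [Fin.lt_def, Fin.val_castSucc, Fin.val_pred] at this ⊢
        omega
      simp only [dif_pos h, dif_neg h', Fin.castPred_castSucc, Fin.succ_pred]
    · have hlt : j < i.succ := lt_of_le_of_lt (not_lt.1 h) (Fin.castSucc_lt_succ (i := i))
      simp [dif_neg h, hlt]

end

/-! ### Magnitude cohomology -/

/-- The magnitude cochains `Hom(MC_{k,ℓ}(X), ℤ)`. -/
abbrev Cochain (X : Type*) [QuasiMetricSpace X] (k : ℕ) (ℓ : ℝ) : Type _ :=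
  MC X k ℓ →ₗ[ℤ] ℤ

/-- The coboundary from degree `k` to degree `k + 1`: precomposition with the differential. -/
def coboundary (X : Type*) [QuasiMetricSpace X] (k : ℕ) (ℓ : ℝ) :
    Cochain X k ℓ →ₗ[ℤ] Cochain X (k + 1) ℓ :=
  LinearMap.lcomp ℤ ℤ (boundary X k ℓ)

/-- The cocycles of degree `k`. -/
def cocycles (X : Type*) [QuasiMetricSpace X] (k : ℕ) (ℓ : ℝ) : Submodule ℤ (Cochain X k ℓ) :=
  LinearMap.ker (coboundary X k ℓ)

/-- The coboundaries of degree `k`; there are no nonzero ones in degree zero. -/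
def coboundaries (X : Type*) [QuasiMetricSpace X] :
    (k : ℕ) → (ℓ : ℝ) → Submodule ℤ (Cochain X k ℓ)
  | 0, _ => ⊥
  | k + 1, ℓ => LinearMap.range (coboundary X k ℓ)

/-- Every coboundary is a cocycle. -/
theorem coboundaries_le_cocycles (X : Type*) [QuasiMetricSpace X] (k : ℕ) (ℓ : ℝ) :
    coboundaries X k ℓ ≤ cocycles X k ℓ := by
  cases k with
  | zero => exact bot_le
  | succ k =>
    rintro _ ⟨φ, rfl⟩
    change (φ ∘ₗ boundary X k ℓ) ∘ₗ boundary X (k + 1) ℓ = 0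
    rw [LinearMap.comp_assoc, boundary_comp_boundary, LinearMap.comp_zero]

/-- The magnitude cohomology group of degree `k` and length `ℓ`: cocycles modulo coboundaries. -/
abbrev MH (X : Type*) [QuasiMetricSpace X] (k : ℕ) (ℓ : ℝ) : Type _ :=
  cocycles X k ℓ ⧸ (coboundaries X k ℓ).submoduleOf (cocycles X k ℓ)

end

end QuasiMetricSpace

/-!
Write the zeta matrix as `1 + N`, where `N` is its off-diagonal part (`offDiagZeta`), and let `δ > 0`
be a lower bound for the distances between distinct points. The entries of `N ^ k` have order at
least `k * δ`, so `1 + N` is invertible (`isUnit_zetaMatrix`), and up to any given exponent its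
inverse agrees with a partial sum of the geometric series `∑ (-1) ^ k • N ^ k`
(`zetaMatrix_inv_eq`). Expanding a matrix power over paths, the sum of the entries of `N ^ k` has at
`q ^ ℓ` the coefficient `#{simplices of degree k and length ℓ}` (`coeff_sum_offDiagZeta_pow`), so the
coefficient of the magnitude at `q ^ ℓ` is the alternating sum of these numbers over `k`
(`exists_coeff_magnitude`).

These numbers are the ranks of the cochain groups. For fixed `ℓ` the cochain complex is bounded,
because a simplex of degree `k` has length at least `k * δ`, so the alternating sum of its ranks is
the alternating sum of the ranks of its cohomology (`finsum_finrank_magnitudeCohomology`). Hence the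
series in the theorem is that of the terms of the magnitude. Only finitely many lengths of simplices
lie below a given bound, and such a Hahn series is the unconditional sum of its terms
(`hasSum_single_coeff`).
-/

namespace QuasiMetricSpace

/-! ### Ranks of magnitude cohomology and the Euler characteristic -/

section Cohomology

variable (X : Type*) [Fintype X] [QuasiMetricSpace X]

theorem finite_magnitudeCohomology (k : ℕ) (ℓ : ℝ) : Module.Finite ℤ (MH X k ℓ) :=
  inferInstance

theorem finrank_cochain (k : ℕ) (ℓ : ℝ) :
    Module.finrank ℤ (Cochain X k ℓ) = Nat.card {x : Fin (k + 1) → X // IsSimplex k ℓ x} := by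
  have := Fintype.ofFinite {x : Fin (k + 1) → X // IsSimplex k ℓ x}
  rw [Module.finrank_linearMap, Module.finrank_finsupp_self, Module.finrank_self, mul_one,
    Nat.card_eq_fintype_card]

theorem finrank_cocycles_add_finrank_coboundaries (k : ℕ) (ℓ : ℝ) :
    Module.finrank ℤ (cocycles X k ℓ) + Module.finrank ℤ (coboundaries X (k + 1) ℓ) =
      Module.finrank ℤ (Cochain X k ℓ) := by
  rw [← Submodule.finrank_quotient_add_finrank (cocycles X k ℓ), add_comm]
  congr 1
  exact (coboundary X k ℓ).quotKerEquivRange.finrank_eq.symm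

theorem finrank_magnitudeCohomology_add_finrank_coboundaries (k : ℕ) (ℓ : ℝ) :
    Module.finrank ℤ (MH X k ℓ) + Module.finrank ℤ (coboundaries X k ℓ) =
      Module.finrank ℤ (cocycles X k ℓ) := by
  rw [← (Submodule.submoduleOfEquivOfLe (coboundaries_le_cocycles X k ℓ)).finrank_eq]
  exact Submodule.finrank_quotient_add_finrank _

theorem finrank_magnitudeCohomology_le (k : ℕ) (ℓ : ℝ) :
    Module.finrank ℤ (MH X k ℓ) ≤ Nat.card {x : Fin (k + 1) → X // IsSimplex k ℓ x} := by
  have h1 := finrank_magnitudeCohomology_add_finrank_coboundaries X k ℓ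
  have h2 := finrank_cocycles_add_finrank_coboundaries X k ℓ
  rw [finrank_cochain] at h2
  omega

/-- The Euler characteristic of the cochain complex in degrees below `K`. The last term is due to the
coboundaries of degree `K`, which come from degree `K - 1`. -/
theorem sum_finrank_magnitudeCohomology (K : ℕ) (ℓ : ℝ) :
    ∑ k ∈ Finset.range K, (-1 : ℚ) ^ k * (Module.finrank ℤ (MH X k ℓ) : ℚ) =
      ∑ k ∈ Finset.range K, (-1 : ℚ) ^ k * (Nat.card {x : Fin (k + 1) → X // IsSimplex k ℓ x} : ℚ)
        + (-1 : ℚ) ^ K * (Module.finrank ℤ (coboundaries X K ℓ) : ℚ) := by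
  induction K with
  | zero =>
    rw [show coboundaries X 0 ℓ = ⊥ from rfl, finrank_bot]
    simp
  | succ K ih =>
    have h1 := finrank_magnitudeCohomology_add_finrank_coboundaries X K ℓ
    have h2 := finrank_cocycles_add_finrank_coboundaries X K ℓ
    rw [finrank_cochain] at h2
    rw [Finset.sum_range_succ, Finset.sum_range_succ, ih, ← h2, ← h1]
    push_cast
    ring

/-- If there are no simplices of length `ℓ` in degrees `K` and above, the Euler characteristic of
the magnitude cohomology is the alternating sum of the numbers of simplices. -/
theorem finsum_finrank_magnitudeCohomology {K : ℕ} {ℓ : ℝ}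
    (h : ∀ k, K ≤ k → ∀ x : Fin (k + 1) → X, ¬ IsSimplex k ℓ x) :
    ∑ᶠ k : ℕ, (-1 : ℚ) ^ k * (Module.finrank ℤ (MH X k ℓ) : ℚ) =
      ∑ k ∈ Finset.range K,
        (-1 : ℚ) ^ k * (Nat.card {x : Fin (k + 1) → X // IsSimplex k ℓ x} : ℚ) := by
  have hc (k : ℕ) (hk : K ≤ k) : Nat.card {x : Fin (k + 1) → X // IsSimplex k ℓ x} = 0 := by
    have : IsEmpty {x : Fin (k + 1) → X // IsSimplex k ℓ x} := ⟨fun x => h k hk x.1 x.2⟩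
    exact Nat.card_of_isEmpty
  rw [finsum_eq_sum_of_support_subset (s := Finset.range K), sum_finrank_magnitudeCohomology]
  · have hb := (coboundaries X K ℓ).finrank_le
    rw [finrank_cochain, hc K le_rfl] at hb
    simp [Nat.le_zero.1 hb]
  · intro k hk
    by_contra hK
    have := finrank_magnitudeCohomology_le X k ℓ
    rw [hc k (by simpa using hK)] at this
    exact hk (by simp [Nat.le_zero.1 this])

end Cohomology

/-! ### Lengths of simplices -/

section Length

theorem exists_pos_le_qdist (X : Type*) [Fintype X] [QuasiMetricSpace X] :
    ∃ δ : ℝ, 0 < δ ∧ ∀ x y : X, x ≠ y → δ ≤ qdist x y := by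
  classical
  rcases (Finset.univ.offDiag : Finset (X × X)).eq_empty_or_nonempty with h | h
  · refine ⟨1, one_pos, fun x y hxy => ?_⟩
    have : (x, y) ∈ (Finset.univ.offDiag : Finset (X × X)) := by simpa using hxy
    simp [h] at this
  · obtain ⟨p, hp, hmin⟩ := Finset.exists_min_image _ (fun p : X × X => qdist p.1 p.2) h
    refine ⟨qdist p.1 p.2, lt_of_le_of_ne (qdist_nonneg _ _) fun h0 => ?_, fun x y hxy =>
      hmin (x, y) (by simpa using hxy)⟩
    exact (Finset.mem_offDiag.1 hp).2.2 (eq_of_qdist_eq_zero _ _ h0.symm)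

theorem IsSimplex.mul_le {X : Type*} [QuasiMetricSpace X] {δ : ℝ}
    (hδ : ∀ x y : X, x ≠ y → δ ≤ qdist x y) {k : ℕ} {ℓ : ℝ} {x : Fin (k + 1) → X}
    (hx : IsSimplex k ℓ x) : k * δ ≤ ℓ := by
  rw [← hx.2, length]
  calc (k : ℝ) * δ = ∑ _i : Fin k, δ := by simp
    _ ≤ _ := Finset.sum_le_sum fun i _ => hδ _ _ (hx.1 i)

end Length

/-! ### Powers of the off-diagonal part of the zeta matrix -/

section Powers

/-- The sum of the entries of a power of a matrix, expanded over tuples of indices. -/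
theorem sum_sum_matrix_pow {X R : Type*} [Fintype X] [DecidableEq X] [CommSemiring R]
    (N : Matrix X X R) (k : ℕ) :
    ∑ x, ∑ y, (N ^ k) x y =
      ∑ p : Fin (k + 1) → X, ∏ i : Fin k, N (p i.castSucc) (p i.succ) := by
  have key : ∀ (k : ℕ) (x : X), ∑ y, (N ^ k) x y = ∑ p : Fin k → X,
      ∏ i : Fin k, N ((Fin.cons x p : Fin (k + 1) → X) i.castSucc)
        ((Fin.cons x p : Fin (k + 1) → X) i.succ) := by
    intro k
    induction k with
    | zero => intro x; simp [Matrix.one_apply]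
    | succ k ih =>
      intro x
      rw [← (Fin.consEquiv fun _ => X).sum_comp, Fintype.sum_prod_type]
      simp_rw [pow_succ', Matrix.mul_apply]
      rw [Finset.sum_comm]
      refine Finset.sum_congr rfl fun z _ => ?_
      rw [← Finset.mul_sum, ih, Finset.mul_sum]
      refine Finset.sum_congr rfl fun p _ => ?_
      rw [Fin.prod_univ_succ]
      simp
  rw [← (Fin.consEquiv fun _ => X).sum_comp, Fintype.sum_prod_type]
  exact Finset.sum_congr rfl fun x _ => key k x

variable (X : Type*) [DecidableEq X] [QuasiMetricSpace X]

/-- The off-diagonal part of the zeta matrix. -/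
noncomputable def offDiagZeta : Matrix X X HahnField :=
  Matrix.of fun x y => if x = y then 0 else HahnSeries.single (qdist x y) (1 : ℚ)

theorem zetaMatrix_eq : zetaMatrix X = 1 + offDiagZeta X := by
  ext1 x y
  by_cases h : x = y
  · subst h
    simp [zetaMatrix, offDiagZeta, qdist_self]
  · simp [zetaMatrix, offDiagZeta, h]

theorem prod_single_one {ι : Type*} (s : Finset ι) (f : ι → ℝ) :
    ∏ i ∈ s, (HahnSeries.single (f i) (1 : ℚ) : HahnField) =
      HahnSeries.single (∑ i ∈ s, f i) 1 := by
  classical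
  induction s using Finset.induction_on with
  | empty => simp
  | insert a s ha ih => rw [Finset.prod_insert ha, Finset.sum_insert ha, ih]; simp

open Classical in
theorem prod_offDiagZeta {k : ℕ} (p : Fin (k + 1) → X) :
    ∏ i : Fin k, offDiagZeta X (p i.castSucc) (p i.succ) =
      if ∀ i : Fin k, p i.castSucc ≠ p i.succ then HahnSeries.single (length p) 1 else 0 := by
  split_ifs with h
  · rw [length, ← prod_single_one]
    exact Finset.prod_congr rfl fun i _ => by simp [offDiagZeta, h i]
  · push Not at h
    obtain ⟨i, hi⟩ := h
    exact Finset.prod_eq_zero (Finset.mem_univ i) (by simp [offDiagZeta, hi])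

/-- The sum of the entries of the `k`-th power of the off-diagonal part of the zeta matrix is the
generating function of the simplices of degree `k` by length. -/
theorem coeff_sum_offDiagZeta_pow [Fintype X] (k : ℕ) (t : ℝ) :
    (∑ x, ∑ y, (offDiagZeta X ^ k) x y).coeff t =
      (Nat.card {x : Fin (k + 1) → X // IsSimplex k t x} : ℚ) := by
  classical
  rw [sum_sum_matrix_pow, HahnSeries.coeff_sum, Nat.card_eq_fintype_card, Fintype.card_subtype,
    Finset.card_filter, Nat.cast_sum]
  refine Finset.sum_congr rfl fun p _ => ?_
  rw [prod_offDiagZeta, IsSimplex]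
  by_cases h1 : ∀ i : Fin k, p i.castSucc ≠ p i.succ
  · rw [if_pos h1, HahnSeries.coeff_single]
    simp [h1, eq_comm]
  · simp [h1]

end Powers

/-! ### Invertibility of the zeta matrix -/

section Inverse

open HahnSeries

theorem le_orderTop_sum {ι : Type*} {s : Finset ι} {f : ι → HahnField} {g : WithTop ℝ}
    (h : ∀ i ∈ s, g ≤ (f i).orderTop) : g ≤ (∑ i ∈ s, f i).orderTop :=
  (addVal ℝ ℚ).map_le_sum h

theorem orderTop_mul_eq_add (f g : HahnField) :
    (f * g).orderTop = f.orderTop + g.orderTop :=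
  (addVal ℝ ℚ).map_mul f g

theorem le_orderTop_offDiagZeta {X : Type*} [DecidableEq X] [QuasiMetricSpace X]
    {δ : ℝ} (hδ : ∀ x y : X, x ≠ y → δ ≤ qdist x y) (x y : X) :
    (δ : WithTop ℝ) ≤ (offDiagZeta X x y).orderTop := by
  by_cases h : x = y
  · simp [offDiagZeta, h]
  · simp [offDiagZeta, h, hδ x y h]

variable {X : Type*} [Fintype X] [DecidableEq X] [QuasiMetricSpace X]

theorem le_orderTop_offDiagZeta_pow {δ : ℝ} (hδ : ∀ x y : X, x ≠ y → δ ≤ qdist x y) (k : ℕ)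
    (x y : X) : ((k * δ : ℝ) : WithTop ℝ) ≤ ((offDiagZeta X ^ k) x y).orderTop := by
  induction k generalizing x y with
  | zero =>
    by_cases h : x = y
    · simp [h]
    · simp [h]
  | succ k ih =>
    rw [pow_succ, Matrix.mul_apply]
    refine le_orderTop_sum fun z _ => ?_
    rw [orderTop_mul_eq_add, Nat.cast_succ, add_mul, one_mul, WithTop.coe_add]
    exact add_le_add (ih x z) (le_orderTop_offDiagZeta hδ z y)

variable (X) in
/-- The zeta matrix has trivial kernel: in a nonzero kernel vector, an entry of
lowest order would be a combination of entries of the vector with coefficients of positive order. -/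
theorem isUnit_zetaMatrix : IsUnit (zetaMatrix X) := by
  rw [Matrix.isUnit_iff_isUnit_det, isUnit_iff_ne_zero]
  intro hdet
  obtain ⟨v, hv0, hv⟩ := Matrix.exists_mulVec_eq_zero_iff.2 hdet
  obtain ⟨δ, hδ0, hδ⟩ := exists_pos_le_qdist X
  obtain ⟨x₀, hx₀⟩ := Function.ne_iff.1 hv0
  obtain ⟨x, -, hx⟩ := Finset.exists_min_image Finset.univ (fun x => (v x).orderTop)
    ⟨x₀, Finset.mem_univ _⟩
  have hne : (v x).orderTop ≠ ⊤ := by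
    intro htop
    have := hx x₀ (Finset.mem_univ _)
    rw [htop, top_le_iff, orderTop_eq_top] at this
    exact hx₀ this
  have hvx : v x = -∑ y, offDiagZeta X x y * v y := by
    rw [zetaMatrix_eq, Matrix.add_mulVec, Matrix.one_mulVec] at hv
    exact eq_neg_of_add_eq_zero_left (congrFun hv x)
  have hle : (δ : WithTop ℝ) + (v x).orderTop ≤ (v x).orderTop := by
    conv_rhs => rw [hvx, orderTop_neg]
    refine le_orderTop_sum fun y _ => ?_
    rw [orderTop_mul_eq_add]
    exact add_le_add (le_orderTop_offDiagZeta hδ x y) (hx y (Finset.mem_univ _))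
  obtain ⟨m, hm⟩ := WithTop.ne_top_iff_exists.1 hne
  rw [← hm, ← WithTop.coe_add, WithTop.coe_le_coe] at hle
  linarith

/-- The inverse of `1 + N` as a finite geometric series in `-N` with its remainder, where `N` is the
off-diagonal part of the zeta matrix. -/
theorem zetaMatrix_inv_eq (K : ℕ) :
    (zetaMatrix X)⁻¹ = ∑ k ∈ Finset.range K, (-1 : HahnField) ^ k • offDiagZeta X ^ k +
      (-1 : HahnField) ^ K • ((zetaMatrix X)⁻¹ * offDiagZeta X ^ K) := by
  have hdet := (Matrix.isUnit_iff_isUnit_det _).1 (isUnit_zetaMatrix X)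
  have hgeom := mul_neg_geom_sum (-offDiagZeta X) K
  rw [sub_neg_eq_add, ← zetaMatrix_eq] at hgeom
  have h := congrArg ((zetaMatrix X)⁻¹ * ·) hgeom
  simp only [Matrix.nonsing_inv_mul_cancel_left _ _ hdet, mul_sub, mul_one] at h
  have hpow (k : ℕ) : (-offDiagZeta X) ^ k = (-1 : HahnField) ^ k • offDiagZeta X ^ k := by
    rw [← smul_pow, neg_one_smul]
  simp only [hpow, Matrix.mul_smul] at h
  rw [h, sub_add_cancel]

theorem exists_le_orderTop_zetaMatrix_inv :
    ∃ m : ℝ, ∀ x y : X, (m : WithTop ℝ) ≤ ((zetaMatrix X)⁻¹ x y).orderTop := by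
  have h (p : X × X) : ∃ m : ℝ, (m : WithTop ℝ) ≤ ((zetaMatrix X)⁻¹ p.1 p.2).orderTop := by
    rcases eq_or_ne ((zetaMatrix X)⁻¹ p.1 p.2).orderTop ⊤ with htop | htop
    · exact ⟨0, htop ▸ le_top⟩
    · exact ⟨_, (WithTop.coe_untop _ htop).le⟩
  choose m hm using h
  obtain ⟨b, hb⟩ := (Set.finite_range m).bddBelow
  exact ⟨b, fun x y => (WithTop.coe_le_coe.2 (hb ⟨(x, y), rfl⟩)).trans (hm (x, y))⟩

variable (X) in
/-- Below any given exponent, the coefficients of the magnitude are alternating sums of numbers of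
simplices of degree less than a fixed `K`, and there are no simplices of degree `K` or more. -/
theorem exists_coeff_magnitude (r : ℝ) : ∃ K : ℕ, ∀ t ≤ r,
    (∀ k, K ≤ k → ∀ x : Fin (k + 1) → X, ¬ IsSimplex k t x) ∧
    (magnitude X).coeff t = ∑ k ∈ Finset.range K,
      (-1 : ℚ) ^ k * (Nat.card {x : Fin (k + 1) → X // IsSimplex k t x} : ℚ) := by
  obtain ⟨δ, hδ0, hδ⟩ := exists_pos_le_qdist X
  obtain ⟨m, hm⟩ := exists_le_orderTop_zetaMatrix_inv (X := X)
  -- `r < K * δ` excludes simplices of degree at least `K`; `r < m + K * δ` makes the remainder of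
  -- the geometric series vanish up to `r`, as `m` bounds the orders of the entries of the inverse.
  obtain ⟨K, hK⟩ := exists_nat_gt (max (r / δ) ((r - m) / δ))
  obtain ⟨hK1, hK2⟩ := max_lt_iff.1 hK
  rw [div_lt_iff₀ hδ0] at hK1 hK2
  refine ⟨K, fun t ht => ⟨fun k hk x hx => ?_, ?_⟩⟩
  · have h1 := hx.mul_le hδ
    have h2 : (K : ℝ) * δ ≤ k * δ := by gcongr
    linarith
  · have hmag : magnitude X =
        ∑ k ∈ Finset.range K, (-1 : HahnField) ^ k * ∑ x, ∑ y, (offDiagZeta X ^ k) x y +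
          (-1 : HahnField) ^ K * ∑ x, ∑ y, ((zetaMatrix X)⁻¹ * offDiagZeta X ^ K) x y := by
      have hxy (x y : X) := congrFun (congrFun (zetaMatrix_inv_eq (X := X) K) x) y
      simp only [Matrix.add_apply, Matrix.sum_apply, Matrix.smul_apply, smul_eq_mul] at hxy
      simp only [magnitude, hxy, Finset.sum_add_distrib, Finset.mul_sum]
      congr 1
      simp_rw [Finset.sum_comm (t := Finset.range K)]
    have hrem : (∑ x, ∑ y, ((zetaMatrix X)⁻¹ * offDiagZeta X ^ K) x y).coeff t = 0 := by
      refine coeff_eq_zero_of_lt_orderTop (lt_of_lt_of_le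
        (WithTop.coe_lt_coe.2 (show t < m + K * δ by linarith)) ?_)
      refine le_orderTop_sum fun x _ => le_orderTop_sum fun y _ => ?_
      rw [Matrix.mul_apply]
      refine le_orderTop_sum fun z _ => ?_
      rw [orderTop_mul_eq_add, WithTop.coe_add]
      exact add_le_add (hm x z) (le_orderTop_offDiagZeta_pow hδ K z y)
    have hsign (k : ℕ) (f : HahnField) :
        ((-1 : HahnField) ^ k * f).coeff t = (-1 : ℚ) ^ k * f.coeff t := by
      rcases Nat.even_or_odd k with h | h <;> simp [h.neg_one_pow]
    rw [hmag, coeff_add, hsign, hrem, mul_zero, add_zero, coeff_sum]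
    exact Finset.sum_congr rfl fun k _ => by rw [hsign, coeff_sum_offDiagZeta_pow]

end Inverse

/-! ### Convergence in the valuation topology -/

section Convergence

/-- A Hahn series is the sum of its terms as soon as it has no negative exponents and only finitely
many exponents below each bound. -/
theorem hasSum_single_coeff {f : HahnField} (hneg : ∀ t < 0, f.coeff t = 0)
    (hfin : ∀ r : ℝ, {t : ℝ | t ≤ r ∧ f.coeff t ≠ 0}.Finite) :
    HasSum (fun t : ℝ≥0 => (HahnSeries.single (t : ℝ) (f.coeff t) : HahnField)) f := by
  rw [HasSum, SummationFilter.unconditional_filter, tendsto_nhds]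
  intro U hU hfU
  obtain ⟨r, hr⟩ := hU f hfU
  have hfin' : {t : ℝ≥0 | (t : ℝ) ≤ r ∧ f.coeff t ≠ 0}.Finite :=
    (hfin r).preimage NNReal.coe_injective.injOn
  filter_upwards [Filter.eventually_ge_atTop hfin'.toFinset] with s hs
  refine hr _ ?_
  rw [← not_le]
  intro hle
  -- the difference has a nonzero coefficient at some exponent `t ≤ r`
  obtain ⟨t, ht⟩ := WithTop.ne_top_iff_exists.1 (ne_top_of_le_ne_top WithTop.coe_ne_top hle)
  rw [← ht, WithTop.coe_le_coe] at hle
  refine HahnSeries.coeff_orderTop_ne ht.symm ?_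
  rw [HahnSeries.coeff_sub, HahnSeries.coeff_sum, sub_eq_zero]
  rcases lt_or_ge t 0 with h0 | h0
  · rw [hneg t h0]
    exact Finset.sum_eq_zero fun u _ =>
      HahnSeries.coeff_single_of_ne (h0.trans_le u.2).ne
  · lift t to ℝ≥0 using h0
    by_cases hts : t ∈ s
    · rw [Finset.sum_eq_single_of_mem t hts fun u _ hu =>
        HahnSeries.coeff_single_of_ne fun h => hu (NNReal.coe_injective h.symm)]
      exact HahnSeries.coeff_single_same _ _
    · have hz : f.coeff t = 0 := by
        by_contra hne
        exact hts (hs (by simpa using ⟨hle, hne⟩))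
      rw [hz]
      exact Finset.sum_eq_zero fun u hu =>
        HahnSeries.coeff_single_of_ne fun h => hts (NNReal.coe_injective h ▸ hu)

theorem coeff_magnitude_of_neg (X : Type*) [Fintype X] [DecidableEq X] [QuasiMetricSpace X]
    {t : ℝ} (ht : t < 0) : (magnitude X).coeff t = 0 := by
  obtain ⟨K, hK⟩ := exists_coeff_magnitude X t
  rw [(hK t le_rfl).2]
  refine Finset.sum_eq_zero fun k _ => ?_
  have : IsEmpty {x : Fin (k + 1) → X // IsSimplex k t x} := by
    refine ⟨fun x => ht.not_ge ?_⟩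
    rw [← x.2.2]
    exact Finset.sum_nonneg fun i _ => qdist_nonneg _ _
  simp

theorem finite_support_magnitude_le (X : Type*) [Fintype X] [DecidableEq X] [QuasiMetricSpace X]
    (r : ℝ) : {t : ℝ | t ≤ r ∧ (magnitude X).coeff t ≠ 0}.Finite := by
  obtain ⟨K, hK⟩ := exists_coeff_magnitude X r
  refine ((Finset.range K).finite_toSet.biUnion fun k _ =>
    Set.finite_range fun x : Fin (k + 1) → X => length x).subset ?_
  rintro t ⟨htr, ht⟩
  rw [(hK t htr).2] at ht
  obtain ⟨k, hk, hne⟩ := Finset.exists_ne_zero_of_sum_ne_zero ht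
  have hcard : Nat.card {x : Fin (k + 1) → X // IsSimplex k t x} ≠ 0 := by
    rintro h
    exact hne (by rw [h]; simp)
  obtain ⟨⟨x, hx⟩⟩ := (Nat.card_ne_zero.1 hcard).1
  exact Set.mem_biUnion hk ⟨x, hx.2⟩

end Convergence

end QuasiMetricSpace

open QuasiMetricSpace in
theorem theorem2p4 (X : Type*) [Fintype X] [DecidableEq X] [QuasiMetricSpace X] :
    -- the magnitude is defined
    IsUnit (zetaMatrix X) ∧
    -- the cohomology groups are finitely generated, so their ranks are natural numbers
    (∀ (k : ℕ) (ℓ : ℝ≥0), Module.Finite ℤ (MH X k ℓ)) ∧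
    -- each sum over `k` is finite
    (∀ ℓ : ℝ≥0, {k : ℕ | Module.finrank ℤ (MH X k ℓ) ≠ 0}.Finite) ∧
    -- the sum over `ℓ` converges to the magnitude
    HasSum (fun ℓ : ℝ≥0 => (HahnSeries.single (ℓ : ℝ)
        (∑ᶠ k : ℕ, (-1 : ℚ) ^ k * (Module.finrank ℤ (MH X k ℓ) : ℚ)) : HahnField))
      (magnitude X) := by
  refine ⟨isUnit_zetaMatrix X, fun k ℓ => finite_magnitudeCohomology X k ℓ, fun ℓ => ?_, ?_⟩
  · obtain ⟨K, hK⟩ := exists_coeff_magnitude X ℓ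
    refine (Finset.range K).finite_toSet.subset fun k hk => ?_
    by_contra hKk
    have : IsEmpty {x : Fin (k + 1) → X // IsSimplex k (ℓ : ℝ) x} :=
      ⟨fun x => (hK ℓ le_rfl).1 k (by simpa using hKk) x.1 x.2⟩
    have hle := finrank_magnitudeCohomology_le X k ℓ
    rw [Nat.card_of_isEmpty] at hle
    exact hk (Nat.le_zero.1 hle)
  · have hcoeff (ℓ : ℝ≥0) : ∑ᶠ k : ℕ, (-1 : ℚ) ^ k * (Module.finrank ℤ (MH X k ℓ) : ℚ) =
        (magnitude X).coeff ℓ := by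
      obtain ⟨K, hK⟩ := exists_coeff_magnitude X ℓ
      rw [(hK ℓ le_rfl).2, finsum_finrank_magnitudeCohomology X (hK ℓ le_rfl).1]
    simp only [hcoeff]
    exact hasSum_single_coeff (fun t ht => coeff_magnitude_of_neg X ht)
      (finite_support_magnitude_le X)
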